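/- Let $d \in \mathbb{N}$ and $p \in [1,\infty)$, and let $\mathcal{P}_p(\mathbb{R}^d)$ be the set of Borel probability measures on $\mathbb{R}^d$ with finite moment of order $p$ with respect to the Euclidean norm $\|\cdot\|$. For $P, Q \in \mathcal{P}_p(\mathbb{R}^d)$ let $$W_p(P,Q) = \Bigl(\inf_{\gamma \in \Gamma(P,Q)} \int_{\mathbb{R}^d\times\mathbb{R}^d} \|x-y\|^p \, d\gamma(x,y)\Bigr)^{1/p},$$ where $\Gamma(P,Q)$ is the set of probability measures on $\mathbb{R}^d \times \mathbb{R}^d$ with marginals $P$ and $Q$. For a sample $X_1,\dots,X_n$ in $\mathbb{R}^d$ let $\widehat{P}_n = n^{-1}\sum_{i=1}^n \delta_{X_i}$ be its empirical distribution, and let $P^n$ be the $n$-fold product measure of $P$ on $(\mathbb{R}^d)^n$, i.e. the law of an i.i.d. sample $(X_1,\dots,X_n)$ from $P$. Let $\mathcal{M} \subseteq \mathcal{P}_p(\mathbb{R}^d)$ be such that $$\lim_{r\to\infty} \sup_{P\in\mathcal{M}} \int_{\|x\|>r} \|x\|^p \, dP(x) = 0.$$ Then $$\forall \varepsilon > 0: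 \qquad \lim_{n\to\infty} \sup_{P\in\mathcal{M}} P^n\bigl[W_p^p(\widehat{P}_n, P) > \varepsilon\bigr] = 0,$$ i.e. $W_p^p(\widehat{P}_n,P) \to 0$ in probability as $n\to\infty$, uniformly in $P \in \mathcal{M}$. -/

import Mathlib

open MeasureTheory Filter Topology
open scoped ENNReal

/-- The set of Borel probability measures on `ℝ^d` (with its Euclidean norm) that have a finite
moment of order `p`. -/
def finiteMomentMeasures (d : ℕ) (p : ℝ) : Set (ProbabilityMeasure (EuclideanSpace ℝ (Fin d))) :=
  {P | ∫⁻ x, ‖x‖ₑ ^ p ∂(P : Measure (EuclideanSpace ℝ (Fin d))) < ∞}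

/-- The couplings of `P` and `Q`: the probability measures on `ℝ^d × ℝ^d` with marginals
`P` and `Q`. -/
def couplings {d : ℕ} (P Q : Measure (EuclideanSpace ℝ (Fin d))) :
    Set (Measure (EuclideanSpace ℝ (Fin d) × EuclideanSpace ℝ (Fin d))) :=
  {γ | IsProbabilityMeasure γ ∧
    (∀ B : Set (EuclideanSpace ℝ (Fin d)), MeasurableSet B → γ (B ×ˢ Set.univ) = P B) ∧
    (∀ B : Set (EuclideanSpace ℝ (Fin d)), MeasurableSet B → γ (Set.univ ×ˢ B) = Q B)}

/-- The `p`-Wasserstein distance, with values in `[0, ∞]`; it is finite when `P` and `Q` are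
probability measures with finite moments of order `p ≥ 1`. -/
noncomputable def wassersteinDist {d : ℕ} (p : ℝ)
    (P Q : Measure (EuclideanSpace ℝ (Fin d))) : ℝ≥0∞ :=
  (⨅ γ ∈ couplings P Q, ∫⁻ z, ‖z.1 - z.2‖ₑ ^ p ∂γ) ^ (1 / p)

/-- The empirical distribution `n⁻¹ ∑ δ_{x i}` of a sample `x` of size `n`
(a probability measure as soon as `n ≥ 1`). -/
noncomputable def empiricalDistribution {d n : ℕ} (x : Fin n → EuclideanSpace ℝ (Fin d)) :
    Measure (EuclideanSpace ℝ (Fin d)) :=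
  (n : ℝ≥0∞)⁻¹ • ∑ i, Measure.dirac (x i)

/-! Fix a finite partition into the tail `{x | R < ‖x‖}` and cells of diameter at most `δ`. Couple
two laws by matching the common mass of each cell within that cell and joining the leftovers by a
normalised product (`cellCoupling`). Matched mass in a small cell travels at most `δ`; everything
else is controlled by the excess cell masses times `R ^ p` and by the two tail moments, which gives
the deterministic bound `wassersteinDist_rpow_le`. For an empirical measure, Chebyshev controls the
finitely many cell masses at a rate free of `P`, and Markov controls the empirical tail moment,
whose mean is the tail moment of `P`. Uniform integrability makes `R`, hence the partition,
independent of `P`, so the convergence is uniform. -/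

/-! ### The cell coupling and its marginals -/

/-- The part of `μ` left over on the cells `A i` after removing the proportion `a i` of its
mass on each of them. -/
noncomputable def cellRemainder {E ι : Type*} [MeasurableSpace E] [Fintype ι]
    (A : ι → Set E) (a : ι → ℝ≥0∞) (μ : Measure E) : Measure E :=
  ∑ i, (1 - a i) • μ.restrict (A i)

lemma sum_restrict_eq_self {E ι : Type*} [MeasurableSpace E] [Fintype ι]
    {A : ι → Set E} (hA : ∀ i, MeasurableSet (A i)) (hd : Pairwise (Function.onFun Disjoint A))
    (hu : ⋃ i, A i = Set.univ) (μ : Measure E) : ∑ i, μ.restrict (A i) = μ := by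
  rw [← Measure.sum_fintype, ← Measure.restrict_iUnion hd hA, hu, Measure.restrict_univ]

lemma sum_add_cellRemainder {E ι : Type*} [MeasurableSpace E] [Fintype ι]
    {A : ι → Set E} (hA : ∀ i, MeasurableSet (A i)) (hd : Pairwise (Function.onFun Disjoint A))
    (hu : ⋃ i, A i = Set.univ) {a : ι → ℝ≥0∞} (ha : ∀ i, a i ≤ 1) (μ : Measure E) :
    ∑ i, a i • μ.restrict (A i) + cellRemainder A a μ = μ := by
  rw [cellRemainder, ← Finset.sum_add_distrib]
  simp_rw [← add_smul, fun i => add_tsub_cancel_of_le (ha i), one_smul]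
  exact sum_restrict_eq_self hA hd hu μ

/-- The weight with which the product of the restrictions of two measures to a cell of masses
`a` and `b` enters a coupling of the two measures. -/
noncomputable def cellWeight (a b : ℝ≥0∞) : ℝ≥0∞ := min a b / (a * b)

lemma cellWeight_comm (a b : ℝ≥0∞) : cellWeight a b = cellWeight b a := by
  rw [cellWeight, cellWeight, min_comm, mul_comm]

lemma cellWeight_mul_mul {a b : ℝ≥0∞} (ha : a ≠ ∞) (hb : b ≠ ∞) :
    cellWeight a b * b * a = min a b := by
  rw [cellWeight, mul_assoc, mul_comm b a]
  -- A cell null for one of the measures has minimum zero, so both sides vanish under `0 / 0 = 0`.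
  rcases eq_or_ne a 0 with rfl | h
  · simp
  rcases eq_or_ne b 0 with rfl | h'
  · simp
  exact ENNReal.div_mul_cancel (mul_ne_zero h h') (ENNReal.mul_ne_top ha hb)

/-- The left side is the matched fraction `min a b / a` of the first mass, so the truncated `1 - a
i` in `cellRemainder` is a true difference. -/
lemma cellWeight_mul_le_one {a b : ℝ≥0∞} (ha : a ≠ ∞) (hb : b ≠ ∞) :
    cellWeight a b * b ≤ 1 := by
  rcases eq_or_ne a 0 with rfl | h
  · simp [cellWeight]
  have h1 : cellWeight a b * b * a ≤ 1 * a := by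
    rw [cellWeight_mul_mul ha hb, one_mul]; exact min_le_left _ _
  exact (ENNReal.mul_le_mul_iff_left h ha).1 h1

/-- The coupling of `μ` and `ν` that keeps as much mass as possible inside the common cells. -/
noncomputable def cellCoupling {E ι : Type*} [MeasurableSpace E] [Fintype ι]
    (A : ι → Set E) (μ ν : Measure E) : Measure (E × E) :=
  ∑ i, cellWeight (μ (A i)) (ν (A i)) • (μ.restrict (A i)).prod (ν.restrict (A i)) +
    (∑ i, (μ (A i) - ν (A i)))⁻¹ •
      (cellRemainder A (fun i => cellWeight (μ (A i)) (ν (A i)) * ν (A i)) μ).prod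
        (cellRemainder A (fun i => cellWeight (ν (A i)) (μ (A i)) * μ (A i)) ν)

lemma cellRemainder_univ {E ι : Type*} [MeasurableSpace E] [Fintype ι]
    (A : ι → Set E) (μ ν : Measure E) [IsFiniteMeasure μ] [IsFiniteMeasure ν] :
    cellRemainder A (fun i => cellWeight (μ (A i)) (ν (A i)) * ν (A i)) μ Set.univ =
      ∑ i, (μ (A i) - ν (A i)) := by
  simp only [cellRemainder, Measure.coe_finsetSum, Finset.sum_apply, Measure.smul_apply,
    Measure.restrict_apply_univ, smul_eq_mul]
  refine Finset.sum_congr rfl fun i _ => ?_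
  rw [ENNReal.sub_mul fun _ _ => measure_ne_top _ _, one_mul,
    cellWeight_mul_mul (measure_ne_top _ _) (measure_ne_top _ _), tsub_min]

lemma cellRemainder_le {E ι : Type*} [MeasurableSpace E] [Fintype ι]
    {A : ι → Set E} (hA : ∀ i, MeasurableSet (A i)) (hd : Pairwise (Function.onFun Disjoint A))
    (hu : ⋃ i, A i = Set.univ) (μ ν : Measure E) [IsFiniteMeasure μ] [IsFiniteMeasure ν] :
    cellRemainder A (fun i => cellWeight (μ (A i)) (ν (A i)) * ν (A i)) μ ≤ μ := by
  conv_rhs => rw [← sum_add_cellRemainder hA hd hu (fun i => cellWeight_mul_le_one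
    (measure_ne_top μ (A i)) (measure_ne_top ν (A i))) μ]
  exact Measure.le_add_left le_rfl

/-- Excess plus overlap `∑ min` is the total mass one for either measure, and the overlap is
symmetric and finite. Hence the leftovers have equal mass, and one normalisation serves both
marginals. -/
lemma sum_tsub_comm {E ι : Type*} [MeasurableSpace E] [Fintype ι]
    {A : ι → Set E} (hA : ∀ i, MeasurableSet (A i)) (hd : Pairwise (Function.onFun Disjoint A))
    (hu : ⋃ i, A i = Set.univ) (μ ν : Measure E) [IsProbabilityMeasure μ]
    [IsProbabilityMeasure ν] :
    ∑ i, (μ (A i) - ν (A i)) = ∑ i, (ν (A i) - μ (A i)) := by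
  have key : ∀ (μ ν : Measure E) [IsProbabilityMeasure μ],
      ∑ i, (μ (A i) - ν (A i)) + ∑ i, min (μ (A i)) (ν (A i)) = 1 := by
    intro μ ν _
    rw [← Finset.sum_add_distrib]
    have h : ∑ i, μ (A i) = 1 := by
      have := congrArg (fun κ : Measure E => κ Set.univ) (sum_restrict_eq_self hA hd hu μ)
      simpa using this
    rw [← h]
    refine Finset.sum_congr rfl fun i _ => ?_
    rw [← tsub_min, tsub_add_cancel_of_le (min_le_left _ _)]
  have h1 := key μ ν
  have h2 := key ν μ
  simp_rw [min_comm (ν _)] at h2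
  refine (ENNReal.add_left_inj ?_).1 (h1.trans h2.symm)
  exact ne_top_of_le_ne_top ENNReal.one_ne_top (h1 ▸ le_add_self)

instance cellRemainder.isFiniteMeasure {E ι : Type*} [MeasurableSpace E] [Fintype ι]
    (A : ι → Set E) (a : ι → ℝ≥0∞) (μ : Measure E) [IsFiniteMeasure μ] :
    IsFiniteMeasure (cellRemainder A a μ) := by
  have : ∀ i, IsFiniteMeasure ((1 - a i) • μ.restrict (A i)) := fun i =>
    Measure.smul_finite _ (ne_top_of_le_ne_top ENNReal.one_ne_top tsub_le_self)
  unfold cellRemainder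
  infer_instance

lemma cellCoupling_marginals {E ι : Type*} [MeasurableSpace E] [Fintype ι]
    {A : ι → Set E} (hA : ∀ i, MeasurableSet (A i)) (hd : Pairwise (Function.onFun Disjoint A))
    (hu : ⋃ i, A i = Set.univ) (μ ν : Measure E) [IsProbabilityMeasure μ]
    [IsProbabilityMeasure ν] (B : Set E) :
    cellCoupling A μ ν (B ×ˢ Set.univ) = μ B ∧ cellCoupling A μ ν (Set.univ ×ˢ B) = ν B := by
  have key : ∀ (m : ℝ≥0∞) (κ : Measure E) (B : Set E), κ Set.univ = m → m ≠ ∞ →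
      m⁻¹ * (κ B * m) = κ B := by
    intro m κ B h hm
    -- With no leftover mass the normaliser is `∞`, but it multiplies a zero measure.
    rcases eq_or_ne m 0 with h0 | h0
    · simp [Measure.measure_univ_eq_zero.1 (h.trans h0)]
    · rw [mul_comm (κ B), ← mul_assoc, ENNReal.inv_mul_cancel h0 hm, one_mul]
  have hm := cellRemainder_univ A μ ν
  have hm' := cellRemainder_univ A ν μ
  rw [← sum_tsub_comm hA hd hu μ ν] at hm'
  have hfin : ∑ i, (μ (A i) - ν (A i)) ≠ ∞ := hm ▸ measure_ne_top _ _
  constructor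
  · conv_rhs => rw [← sum_add_cellRemainder hA hd hu (fun i => cellWeight_mul_le_one
      (measure_ne_top μ (A i)) (measure_ne_top ν (A i))) μ]
    simp only [cellCoupling, Measure.add_apply, Measure.coe_finsetSum, Finset.sum_apply,
      Measure.smul_apply, Measure.prod_prod, smul_eq_mul, Measure.restrict_apply_univ, hm']
    rw [key _ _ _ hm hfin]
    congr 1
    exact Finset.sum_congr rfl fun i _ => by ring
  · conv_rhs => rw [← sum_add_cellRemainder hA hd hu (fun i => cellWeight_mul_le_one
      (measure_ne_top ν (A i)) (measure_ne_top μ (A i))) ν]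
    simp only [cellCoupling, Measure.add_apply, Measure.coe_finsetSum, Finset.sum_apply,
      Measure.smul_apply, Measure.prod_prod, smul_eq_mul, Measure.restrict_apply_univ, hm]
    rw [mul_comm (∑ i, (μ (A i) - ν (A i))), key _ _ _ hm' hfin]
    congr 1
    exact Finset.sum_congr rfl fun i _ => by rw [cellWeight_comm]; ring

lemma cellCoupling_mem_couplings {d : ℕ} {ι : Type*} [Fintype ι]
    {A : ι → Set (EuclideanSpace ℝ (Fin d))} (hA : ∀ i, MeasurableSet (A i))
    (hd : Pairwise (Function.onFun Disjoint A)) (hu : ⋃ i, A i = Set.univ)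
    (μ ν : Measure (EuclideanSpace ℝ (Fin d))) [IsProbabilityMeasure μ]
    [IsProbabilityMeasure ν] : cellCoupling A μ ν ∈ couplings μ ν := by
  refine ⟨⟨?_⟩, fun B _ => (cellCoupling_marginals hA hd hu μ ν B).1,
    fun B _ => (cellCoupling_marginals hA hd hu μ ν B).2⟩
  rw [← Set.univ_prod_univ, (cellCoupling_marginals hA hd hu μ ν Set.univ).1, measure_univ]

/-! ### Transport cost of the cell coupling -/

lemma lintegral_enorm_sub_rpow_prod_le {E : Type*} [NormedAddCommGroup E] [MeasurableSpace E]
    [BorelSpace E] {p : ℝ} (hp : 1 ≤ p) (μ ν : Measure E) [SFinite μ] [SFinite ν] :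
    ∫⁻ z, ‖z.1 - z.2‖ₑ ^ p ∂(μ.prod ν) ≤
      2 ^ (p - 1) * (ν Set.univ * ∫⁻ x, ‖x‖ₑ ^ p ∂μ + μ Set.univ * ∫⁻ y, ‖y‖ₑ ^ p ∂ν) := by
  have h0 : (0 : ℝ) ≤ p := zero_le_one.trans hp
  calc ∫⁻ z, ‖z.1 - z.2‖ₑ ^ p ∂(μ.prod ν)
      ≤ ∫⁻ z, 2 ^ (p - 1) * (‖z.1‖ₑ ^ p * 1 + 1 * ‖z.2‖ₑ ^ p) ∂(μ.prod ν) := by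
        refine lintegral_mono fun z => ?_
        rw [mul_one, one_mul]
        exact (ENNReal.rpow_le_rpow (enorm_sub_le) h0).trans
          (ENNReal.rpow_add_le_mul_rpow_add_rpow _ _ hp)
    _ = _ := by
        have h1 : Measurable fun x : E => ‖x‖ₑ ^ p := by fun_prop
        rw [lintegral_const_mul _ (by fun_prop), lintegral_add_left (by fun_prop),
          lintegral_prod_mul h1.aemeasurable aemeasurable_const,
          lintegral_prod_mul aemeasurable_const h1.aemeasurable]
        simp [mul_comm]

/-- Off the tail cell the norm is at most `R` and the remainder's mass is the total excess; on it
the remainder is dominated by `μ`. -/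
lemma lintegral_enorm_rpow_cellRemainder_le {E ι : Type*} [NormedAddCommGroup E]
    [MeasurableSpace E] [Fintype ι] {p : ℝ} (hp : 0 ≤ p) {A : ι → Set E}
    (hA : ∀ i, MeasurableSet (A i))
    (hd : Pairwise (Function.onFun Disjoint A)) (hu : ⋃ i, A i = Set.univ)
    (μ ν : Measure E) [IsFiniteMeasure μ] [IsFiniteMeasure ν]
    {o : ι} {R : ℝ≥0∞} (hR : ∀ x ∉ A o, ‖x‖ₑ ≤ R) :
    ∫⁻ x, ‖x‖ₑ ^ p ∂(cellRemainder A (fun i => cellWeight (μ (A i)) (ν (A i)) * ν (A i)) μ) ≤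
      R ^ p * ∑ i, (μ (A i) - ν (A i)) + ∫⁻ x in A o, ‖x‖ₑ ^ p ∂μ := by
  rw [← lintegral_add_compl _ (hA o), add_comm]
  refine add_le_add ?_ (lintegral_mono' (Measure.restrict_mono_measure
    (cellRemainder_le hA hd hu μ ν) _) le_rfl)
  calc _ ≤ ∫⁻ x in (A o)ᶜ, R ^ p
          ∂(cellRemainder A (fun i => cellWeight (μ (A i)) (ν (A i)) * ν (A i)) μ) :=
        setLIntegral_mono measurable_const fun x hx => ENNReal.rpow_le_rpow (hR x hx) hp
    _ ≤ _ := by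
        rw [setLIntegral_const, ← cellRemainder_univ A μ ν]
        gcongr
        exact Set.subset_univ _

lemma lintegral_enorm_sub_rpow_cellCoupling_le {E ι : Type*} [NormedAddCommGroup E]
    [MeasurableSpace E] [BorelSpace E] [Fintype ι] {p : ℝ} (hp : 1 ≤ p) {A : ι → Set E}
    (hA : ∀ i, MeasurableSet (A i))
    (hd : Pairwise (Function.onFun Disjoint A)) (hu : ⋃ i, A i = Set.univ)
    (μ ν : Measure E) [IsProbabilityMeasure μ] [IsProbabilityMeasure ν]
    {o : ι} {δ R : ℝ≥0∞} (hδ : ∀ i ≠ o, ∀ x ∈ A i, ∀ y ∈ A i, ‖x - y‖ₑ ≤ δ)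
    (hR : ∀ x ∉ A o, ‖x‖ₑ ≤ R) :
    ∫⁻ z, ‖z.1 - z.2‖ₑ ^ p ∂(cellCoupling A μ ν) ≤
      δ ^ p + 2 ^ p * (R ^ p * ∑ i, (μ (A i) - ν (A i)) +
        (∫⁻ x in A o, ‖x‖ₑ ^ p ∂μ + ∫⁻ x in A o, ‖x‖ₑ ^ p ∂ν)) := by
  classical
  have h0 : (0 : ℝ) ≤ p := zero_le_one.trans hp
  have hcell : ∀ i ≠ o, ∫⁻ z, ‖z.1 - z.2‖ₑ ^ p
      ∂(cellWeight (μ (A i)) (ν (A i)) • (μ.restrict (A i)).prod (ν.restrict (A i))) ≤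
      δ ^ p * μ (A i) := by
    intro i hi
    rw [lintegral_smul_measure, Measure.prod_restrict]
    calc cellWeight (μ (A i)) (ν (A i)) •
          ∫⁻ z in A i ×ˢ A i, ‖z.1 - z.2‖ₑ ^ p ∂(μ.prod ν)
        ≤ cellWeight (μ (A i)) (ν (A i)) • ∫⁻ z in A i ×ˢ A i, δ ^ p ∂(μ.prod ν) := by
          rw [smul_eq_mul, smul_eq_mul]
          gcongr 1
          exact setLIntegral_mono measurable_const fun z hz =>
            ENNReal.rpow_le_rpow (hδ i hi _ hz.1 _ hz.2) h0
      _ = δ ^ p * (cellWeight (μ (A i)) (ν (A i)) * ν (A i) * μ (A i)) := by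
          rw [setLIntegral_const, Measure.prod_prod, smul_eq_mul]; ring
      _ ≤ δ ^ p * μ (A i) := by
          rw [cellWeight_mul_mul (measure_ne_top _ _) (measure_ne_top _ _)]
          gcongr
          exact min_le_left _ _
  have htail : ∫⁻ z, ‖z.1 - z.2‖ₑ ^ p
      ∂(cellWeight (μ (A o)) (ν (A o)) • (μ.restrict (A o)).prod (ν.restrict (A o))) ≤
      2 ^ (p - 1) * (∫⁻ x in A o, ‖x‖ₑ ^ p ∂μ + ∫⁻ x in A o, ‖x‖ₑ ^ p ∂ν) := by
    rw [lintegral_smul_measure, smul_eq_mul]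
    refine (mul_le_mul_right (lintegral_enorm_sub_rpow_prod_le hp _ _) _).trans ?_
    rw [Measure.restrict_apply_univ, Measure.restrict_apply_univ, mul_left_comm, mul_add,
      ← mul_assoc (cellWeight _ _), ← mul_assoc (cellWeight _ _)]
    gcongr
    · exact mul_le_of_le_one_left zero_le
        (cellWeight_mul_le_one (measure_ne_top _ _) (measure_ne_top _ _))
    · refine mul_le_of_le_one_left zero_le ?_
      rw [cellWeight_comm]
      exact cellWeight_mul_le_one (measure_ne_top _ _) (measure_ne_top _ _)
  have hcells : ∑ i, ∫⁻ z, ‖z.1 - z.2‖ₑ ^ p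
      ∂(cellWeight (μ (A i)) (ν (A i)) • (μ.restrict (A i)).prod (ν.restrict (A i))) ≤
      2 ^ (p - 1) * (∫⁻ x in A o, ‖x‖ₑ ^ p ∂μ + ∫⁻ x in A o, ‖x‖ₑ ^ p ∂ν) + δ ^ p := by
    rw [← Finset.add_sum_erase _ _ (Finset.mem_univ o)]
    refine add_le_add htail ?_
    calc _ ≤ ∑ i ∈ Finset.univ.erase o, δ ^ p * μ (A i) :=
          Finset.sum_le_sum fun i hi => hcell i (Finset.ne_of_mem_erase hi)
      _ ≤ ∑ i, δ ^ p * μ (A i) :=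
          Finset.sum_le_sum_of_subset (Finset.subset_univ _)
      _ = δ ^ p * ∑ i, (μ.restrict (A i)) Set.univ := by simp [Finset.mul_sum]
      _ = δ ^ p := by
          rw [← Finset.sum_apply, ← Measure.coe_finsetSum, sum_restrict_eq_self hA hd hu,
            measure_univ, mul_one]
  have hrem : ∫⁻ z, ‖z.1 - z.2‖ₑ ^ p ∂((∑ i, (μ (A i) - ν (A i)))⁻¹ •
      (cellRemainder A (fun i => cellWeight (μ (A i)) (ν (A i)) * ν (A i)) μ).prod
        (cellRemainder A (fun i => cellWeight (ν (A i)) (μ (A i)) * μ (A i)) ν)) ≤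
      2 ^ (p - 1) * ((R ^ p * ∑ i, (μ (A i) - ν (A i)) + ∫⁻ x in A o, ‖x‖ₑ ^ p ∂μ) +
        (R ^ p * ∑ i, (μ (A i) - ν (A i)) + ∫⁻ x in A o, ‖x‖ₑ ^ p ∂ν)) := by
    rw [lintegral_smul_measure, smul_eq_mul]
    refine (mul_le_mul_right (lintegral_enorm_sub_rpow_prod_le hp _ _) _).trans ?_
    have h1 := lintegral_enorm_rpow_cellRemainder_le h0 hA hd hu μ ν hR
    have h2 := lintegral_enorm_rpow_cellRemainder_le h0 hA hd hu ν μ hR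
    rw [← sum_tsub_comm hA hd hu μ ν] at h2
    rw [cellRemainder_univ A μ ν, cellRemainder_univ A ν μ, ← sum_tsub_comm hA hd hu μ ν,
      ← mul_add, mul_left_comm, ← mul_assoc (_⁻¹)]
    gcongr 2 ^ (p - 1) * ?_
    exact (mul_le_of_le_one_left zero_le (ENNReal.inv_mul_le_one _)).trans (add_le_add h1 h2)
  rw [cellCoupling, lintegral_add_measure, lintegral_finsetSum_measure]
  refine (add_le_add hcells hrem).trans (le_of_eq ?_)
  -- The tail moments are charged twice, by the matched tail cell and by the remainder, each with
  -- the convexity constant `2 ^ (p - 1)`.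
  have h2 : (2 : ℝ≥0∞) ^ p = 2 ^ (p - 1) * 2 := by
    conv_lhs => rw [← sub_add_cancel p 1, ENNReal.rpow_add _ _ two_ne_zero ENNReal.ofNat_ne_top,
      ENNReal.rpow_one]
  rw [h2]
  ring

lemma wassersteinDist_rpow_le {d : ℕ} {ι : Type*} [Fintype ι] {p : ℝ} (hp : 1 ≤ p)
    {A : ι → Set (EuclideanSpace ℝ (Fin d))} (hA : ∀ i, MeasurableSet (A i))
    (hd : Pairwise (Function.onFun Disjoint A)) (hu : ⋃ i, A i = Set.univ)
    (μ ν : Measure (EuclideanSpace ℝ (Fin d))) [IsProbabilityMeasure μ] [IsProbabilityMeasure ν]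
    {o : ι} {δ R : ℝ≥0∞} (hδ : ∀ i ≠ o, ∀ x ∈ A i, ∀ y ∈ A i, ‖x - y‖ₑ ≤ δ)
    (hR : ∀ x ∉ A o, ‖x‖ₑ ≤ R) :
    wassersteinDist p μ ν ^ p ≤
      δ ^ p + 2 ^ p * (R ^ p * ∑ i, (μ (A i) - ν (A i)) +
        (∫⁻ x in A o, ‖x‖ₑ ^ p ∂μ + ∫⁻ x in A o, ‖x‖ₑ ^ p ∂ν)) := by
  have h0 : p ≠ 0 := (zero_lt_one.trans_le hp).ne'
  rw [wassersteinDist, ← ENNReal.rpow_mul, one_div, inv_mul_cancel₀ h0, ENNReal.rpow_one]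
  exact (iInf₂_le _ (cellCoupling_mem_couplings hA hd hu μ ν)).trans
    (lintegral_enorm_sub_rpow_cellCoupling_le hp hA hd hu μ ν hδ hR)

/-! ### Deviation bounds for the empirical measure -/

open ProbabilityTheory in
lemma measure_pi_le_sum_indicator_deviation {E : Type*} [MeasurableSpace E] (P : Measure E)
    [IsProbabilityMeasure P] {A : Set E} (hA : MeasurableSet A) {n : ℕ} (hn : n ≠ 0) {η : ℝ}
    (hη : 0 < η) :
    (Measure.pi fun _ : Fin n => P)
      {x | η * n ≤ |∑ i, A.indicator (1 : E → ℝ) (x i) - n * P.real A|} ≤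
      ENNReal.ofReal (1 / (n * η ^ 2)) := by
  have hn' : (0 : ℝ) < n := by positivity
  have hmem : ∀ Q : Measure E, IsProbabilityMeasure Q → MemLp (A.indicator (1 : E → ℝ)) 2 Q :=
    fun Q _ => memLp_indicator_const 2 hA 1 (Or.inr (measure_ne_top _ _))
  have hY : ∀ i : Fin n, MemLp (fun x : Fin n → E => A.indicator (1 : E → ℝ) (x i)) 2
      (Measure.pi fun _ : Fin n => P) := fun i =>
    (hmem P inferInstance).comp_measurePreserving (measurePreserving_eval _ i)
  have hint : ∫ x, ∑ i, A.indicator (1 : E → ℝ) (x i) ∂(Measure.pi fun _ : Fin n => P) =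
      n * P.real A := by
    rw [integral_finsetSum _ fun i _ => (hY i).integrable one_le_two]
    have : ∀ i : Fin n, ∫ x, A.indicator (1 : E → ℝ) (x i) ∂(Measure.pi fun _ : Fin n => P) =
        P.real A := fun i => by
      rw [integral_comp_eval (μ := fun _ : Fin n => P)
        (hmem P inferInstance).aestronglyMeasurable, integral_indicator_one hA]
    simp [this]
  have hvar : Var[fun x : Fin n → E => ∑ i, A.indicator (1 : E → ℝ) (x i);
      Measure.pi fun _ : Fin n => P] ≤ n := by
    have h := variance_sum_pi (μ := fun _ : Fin n => P)
      (X := fun _ => A.indicator (1 : E → ℝ)) fun _ => hmem P inferInstance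
    have h1 : Var[A.indicator (1 : E → ℝ); P] ≤ 1 := by
      refine (variance_le_sq_of_bounded (a := 0) (b := 1) (Eventually.of_forall fun x => ?_)
        (hmem P inferInstance).aemeasurable).trans (by norm_num)
      by_cases hx : x ∈ A <;> simp [hx]
    have h2 : (fun x : Fin n → E => ∑ i, A.indicator (1 : E → ℝ) (x i)) =
        ∑ i, fun x : Fin n → E => A.indicator (1 : E → ℝ) (x i) := by
      ext x; simp
    rw [h2, h]
    calc _ ≤ ∑ _i : Fin n, (1 : ℝ) := Finset.sum_le_sum fun _ _ => h1
      _ = n := by simp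
  have hch := meas_ge_le_variance_div_sq
    (memLp_finsetSum (Finset.univ : Finset (Fin n)) fun i _ => hY i) (mul_pos hη hn')
  rw [hint] at hch
  refine hch.trans (ENNReal.ofReal_le_ofReal ?_)
  calc _ ≤ n / (η * n) ^ 2 := by gcongr
    _ = 1 / (n * η ^ 2) := by field_simp

variable {d : ℕ}

instance empiricalDistribution.isProbabilityMeasure {n : ℕ} [NeZero n]
    (x : Fin n → EuclideanSpace ℝ (Fin d)) : IsProbabilityMeasure (empiricalDistribution x) := by
  refine ⟨?_⟩
  simp [empiricalDistribution, ENNReal.inv_mul_cancel, NeZero.ne n]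

lemma empiricalDistribution_real_apply {n : ℕ} (x : Fin n → EuclideanSpace ℝ (Fin d))
    {A : Set (EuclideanSpace ℝ (Fin d))} (hA : MeasurableSet A) :
    (empiricalDistribution x).real A =
      (n : ℝ)⁻¹ * ∑ i, A.indicator (1 : EuclideanSpace ℝ (Fin d) → ℝ) (x i) := by
  have : ∀ y, Measure.dirac y A = ENNReal.ofReal (A.indicator (1 : EuclideanSpace ℝ (Fin d) → ℝ) y) := fun y => by
    by_cases hy : y ∈ A <;> simp [hA, hy]
  simp only [empiricalDistribution, Measure.real, Measure.smul_apply, Measure.coe_finsetSum,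
    Finset.sum_apply, this, smul_eq_mul, ENNReal.toReal_mul, ENNReal.toReal_inv,
    ENNReal.toReal_natCast]
  rw [← ENNReal.ofReal_sum_of_nonneg, ENNReal.toReal_ofReal]
  · exact Finset.sum_nonneg fun i _ => Set.indicator_nonneg (fun _ _ => zero_le_one) _
  · exact fun i _ => Set.indicator_nonneg (fun _ _ => zero_le_one) _

/-- The transport bound involves only truncated excesses, so one side of Chebyshev suffices. -/
lemma measure_pi_empiricalDistribution_deviation_le {n : ℕ} (hn : n ≠ 0)
    (P : Measure (EuclideanSpace ℝ (Fin d))) [IsProbabilityMeasure P]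
    {A : Set (EuclideanSpace ℝ (Fin d))} (hA : MeasurableSet A) {η : ℝ} (hη : 0 < η) :
    (Measure.pi fun _ : Fin n => P)
      {x | ENNReal.ofReal η < empiricalDistribution x A - P A} ≤
      ENNReal.ofReal (1 / (n * η ^ 2)) := by
  have hn' : (0 : ℝ) < n := by positivity
  have : NeZero n := ⟨hn⟩
  refine (measure_mono fun x hx => ?_).trans (measure_pi_le_sum_indicator_deviation P hA hn hη)
  simp only [Set.mem_ofPred_eq] at hx ⊢
  have h1 : η < (empiricalDistribution x).real A - P.real A := by
    rw [← ofReal_measureReal (μ := P), ← ofReal_measureReal (μ := empiricalDistribution x),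
      ← ENNReal.ofReal_sub _ measureReal_nonneg] at hx
    exact ENNReal.ofReal_lt_ofReal_iff_of_nonneg hη.le |>.1 hx
  rw [empiricalDistribution_real_apply x hA] at h1
  refine le_trans ?_ (le_abs_self _)
  have h2 := mul_le_mul_of_nonneg_right h1.le hn'.le
  rw [sub_mul, mul_right_comm, inv_mul_cancel₀ hn'.ne', one_mul] at h2
  linarith

lemma lintegral_empiricalDistribution {n : ℕ} (x : Fin n → EuclideanSpace ℝ (Fin d))
    {f : EuclideanSpace ℝ (Fin d) → ℝ≥0∞} :
    ∫⁻ y, f y ∂(empiricalDistribution x) = (n : ℝ≥0∞)⁻¹ * ∑ i, f (x i) := by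
  simp [empiricalDistribution, lintegral_finsetSum_measure]

lemma measure_pi_lintegral_empiricalDistribution_le {n : ℕ} (hn : n ≠ 0)
    (P : Measure (EuclideanSpace ℝ (Fin d))) [IsProbabilityMeasure P]
    {f : EuclideanSpace ℝ (Fin d) → ℝ≥0∞} (hf : Measurable f) {c : ℝ≥0∞} (hc : c ≠ 0)
    (hc' : c ≠ ∞) :
    (Measure.pi fun _ : Fin n => P)
      {x | c ≤ ∫⁻ y, f y ∂(empiricalDistribution x)} ≤ (∫⁻ y, f y ∂P) / c := by
  have heval : ∀ i, Measurable fun x : Fin n → EuclideanSpace ℝ (Fin d) => f (x i) :=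
    fun i => hf.comp (measurable_pi_apply i)
  have hsum : Measurable fun x : Fin n → EuclideanSpace ℝ (Fin d) => ∑ i, f (x i) :=
    Finset.measurable_sum _ fun i _ => heval i
  simp_rw [lintegral_empiricalDistribution]
  refine (meas_ge_le_lintegral_div (hsum.const_mul _).aemeasurable hc hc').trans (le_of_eq ?_)
  congr 1
  rw [lintegral_const_mul _ hsum,
    lintegral_finsetSum _ fun i _ => heval i]
  have : ∀ i : Fin n, ∫⁻ x, f (x i) ∂(Measure.pi fun _ : Fin n => P) = ∫⁻ y, f y ∂P := fun i =>
    (measurePreserving_eval (fun _ : Fin n => P) i).lintegral_comp hf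
  simp only [this, Finset.sum_const, Finset.card_univ, Fintype.card_fin, nsmul_eq_mul]
  rw [← mul_assoc, ENNReal.inv_mul_cancel (by simpa) (ENNReal.natCast_ne_top n), one_mul]

/-! ### A finite partition with small cells -/

/-- A finite measurable partition into the complement of a ball and sets of small diameter. -/
lemma exists_measurable_partition {E : Type*} [NormedAddCommGroup E] [ProperSpace E]
    [MeasurableSpace E] [BorelSpace E] (R : ℝ) {δ : ℝ} (hδ : 0 < δ) :
    ∃ N : ℕ, ∃ A : Option (Fin (N + 1)) → Set E, (∀ i, MeasurableSet (A i)) ∧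
      Pairwise (Function.onFun Disjoint A) ∧ ⋃ i, A i = Set.univ ∧ A none = {x | R < ‖x‖} ∧
      ∀ i ≠ none, ∀ x ∈ A i, ∀ y ∈ A i, ‖x - y‖ ≤ δ := by
  classical
  set e := TopologicalSpace.denseSeq E
  obtain ⟨N, hN⟩ : ∃ N : ℕ, ∀ x ∈ Metric.closedBall (0 : E) R, ∃ k ≤ N, dist (e k) x < δ / 2 := by
    obtain ⟨t, ht⟩ := (isCompact_closedBall (0 : E) R).elim_finite_subcover
      (fun k => Metric.ball (e k) (δ / 2)) (fun _ => Metric.isOpen_ball) (fun x _ => by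
        obtain ⟨k, hk⟩ := Metric.denseRange_iff.1 (TopologicalSpace.denseRange_denseSeq E) x
          (δ / 2) (half_pos hδ)
        exact Set.mem_iUnion.2 ⟨k, hk⟩)
    refine ⟨t.sup id, fun x hx => ?_⟩
    obtain ⟨k, hk, hx⟩ := Set.mem_iUnion₂.1 (ht hx)
    exact ⟨k, Finset.le_sup (f := id) hk, by rwa [dist_comm]⟩
  let _ : MeasurableSpace (Option (Fin (N + 1))) := ⊤
  -- Cells are the fibres of the nearest-point index among the net points `e 0, …, e N`, a
  -- measurable choice.
  let g : E → Option (Fin (N + 1)) := fun x =>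
    if R < ‖x‖ then none else some (Fin.ofNat (N + 1) (SimpleFunc.nearestPtInd e N x))
  have hg : Measurable g :=
    Measurable.ite (measurableSet_lt measurable_const measurable_norm) measurable_const
      ((measurable_of_countable fun k : ℕ => some (Fin.ofNat (N + 1) k)).comp
        (SimpleFunc.nearestPtInd e N).measurable)
  refine ⟨N, fun i => g ⁻¹' {i}, fun i => hg (measurableSet_singleton i),
    fun i j hij => Disjoint.preimage _ (by simpa using hij), ?_, ?_, ?_⟩
  · ext x; simp
  · ext x; simp [g]
  · intro i hi x hx y hy
    -- The default in `getD` is never used, since `i ≠ none`.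
    have key : ∀ x, g x = i → dist (e ((i.getD 0 : Fin (N + 1)) : ℕ)) x ≤ δ / 2 := by
      intro x hx
      have hR : ¬ R < ‖x‖ := fun h => hi (by rw [← hx]; simp [g, h])
      obtain ⟨k, hk, hkx⟩ := hN x (by simpa using hR)
      have h1 := SimpleFunc.edist_nearestPt_le e x hk
      have h2 : SimpleFunc.nearestPt e N x = e ((i.getD 0 : Fin (N + 1)) : ℕ) := by
        rw [← hx]
        simp [g, hR, SimpleFunc.nearestPt,
          Nat.mod_eq_of_lt (Nat.lt_succ_of_le (SimpleFunc.nearestPtInd_le e N x))]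
      rw [h2, edist_dist, edist_dist, ENNReal.ofReal_le_ofReal_iff dist_nonneg] at h1
      exact h1.trans hkx.le
    rw [← dist_eq_norm]
    have := dist_triangle_left x y (e ((i.getD 0 : Fin (N + 1)) : ℕ))
    linarith [key x hx, key y hy]

/-! ### Uniform convergence -/

theorem mainTheorem2 (d : ℕ) (p : ℝ) (hp : 1 ≤ p)
    (M : Set (ProbabilityMeasure (EuclideanSpace ℝ (Fin d))))
    (hM : M ⊆ finiteMomentMeasures d p)
    (hUI : Tendsto
      (fun r : ℝ => ⨆ P ∈ M,
        ∫⁻ x in {x : EuclideanSpace ℝ (Fin d) | r < ‖x‖}, ‖x‖ₑ ^ p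
          ∂(P : Measure (EuclideanSpace ℝ (Fin d))))
      atTop (𝓝 0)) :
    ∀ ε : ℝ, 0 < ε →
      Tendsto
        (fun n : ℕ => ⨆ P ∈ M,
          (Measure.pi fun _ : Fin n => (P : Measure (EuclideanSpace ℝ (Fin d))))
            {x | ENNReal.ofReal ε <
              wassersteinDist p (empiricalDistribution x)
                (P : Measure (EuclideanSpace ℝ (Fin d))) ^ p})
        atTop (𝓝 0) := by
  intro ε hε
  have h0 : (0 : ℝ) < p := zero_lt_one.trans_le hp
  rw [ENNReal.tendsto_nhds_zero]
  intro θ hθ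
  have hε4 : 0 < ε / 4 := by positivity
  set K : ℝ≥0∞ := 2 ^ p with hK
  have hK0 : K ≠ 0 := by simp [hK]
  have hKtop : K ≠ ∞ := ENNReal.rpow_ne_top_of_nonneg h0.le ENNReal.ofNat_ne_top
  -- The budget `ε` is split into four quarters: `δ ^ p`, and `K * c` for the excess masses and for
  -- each of the two tails.
  set c : ℝ≥0∞ := ENNReal.ofReal (ε / 4) / K with hc
  have hKc : K * c = ENNReal.ofReal (ε / 4) := ENNReal.mul_div_cancel hK0 hKtop
  have hc0 : c ≠ 0 := (ENNReal.div_pos (by simpa using hε4) hKtop).ne'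
  have hctop : c ≠ ∞ := ENNReal.div_ne_top ENNReal.ofReal_ne_top hK0
  -- The bound `c` is for the tail of `P` itself; `θ / 2 * c` makes Markov's bound at level `c` at
  -- most `θ / 2`.
  have hτ : 0 < min c (θ / 2 * c) :=
    lt_min (pos_iff_ne_zero.2 hc0) (ENNReal.mul_pos (ENNReal.half_pos hθ.ne').ne' hc0)
  obtain ⟨R, hRT, hR0⟩ :=
    ((ENNReal.tendsto_nhds_zero.1 hUI _ hτ).and (eventually_ge_atTop 0)).exists
  obtain ⟨N, A, hA, hd, hu, hAo, hAδ⟩ := exists_measurable_partition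
    (E := EuclideanSpace ℝ (Fin d)) R (Real.rpow_pos_of_pos hε4 (1 / p))
  have hAR : ∀ x ∉ A none, ‖x‖ₑ ≤ ENNReal.ofReal R := fun x hx => by
    rw [hAo, Set.mem_ofPred_eq, not_lt] at hx
    rw [← ofReal_norm]
    exact ENNReal.ofReal_le_ofReal hx
  have hAδ' : ∀ i ≠ none, ∀ x ∈ A i, ∀ y ∈ A i,
      ‖x - y‖ₑ ≤ ENNReal.ofReal ((ε / 4) ^ (1 / p)) := fun i hi x hx y hy => by
    rw [← ofReal_norm]
    exact ENNReal.ofReal_le_ofReal (hAδ i hi x hx y hy)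
  have hδp : ENNReal.ofReal ((ε / 4) ^ (1 / p)) ^ p = ENNReal.ofReal (ε / 4) := by
    rw [← ENNReal.ofReal_rpow_of_pos hε4, ← ENNReal.rpow_mul, one_div,
      inv_mul_cancel₀ h0.ne', ENNReal.rpow_one]
  -- There are `N + 2` cells: `N + 1` small ones and the tail.
  obtain ⟨η, hη, hηc⟩ := ENNReal.exists_nnreal_pos_mul_lt
    (a := ENNReal.ofReal R ^ p * (N + 2 : ℕ)) (b := c)
    (ENNReal.mul_ne_top (ENNReal.rpow_ne_top_of_nonneg h0.le ENNReal.ofReal_ne_top)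
      (ENNReal.natCast_ne_top _)) hc0
  have hlim : Tendsto (fun n : ℕ => ((N + 2 : ℕ) : ℝ≥0∞) *
      ENNReal.ofReal (1 / (n * (η : ℝ) ^ 2))) atTop (𝓝 0) := by
    have h1 : Tendsto (fun n : ℕ => 1 / (n * (η : ℝ) ^ 2)) atTop (𝓝 0) := by
      simp_rw [one_div]
      exact tendsto_inv_atTop_zero.comp
        (tendsto_natCast_atTop_atTop.atTop_mul_const (by positivity))
    have h2 := ENNReal.Tendsto.const_mul (ENNReal.tendsto_ofReal h1)
      (Or.inr (ENNReal.natCast_ne_top (N + 2)))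
    simpa using h2
  filter_upwards [ENNReal.tendsto_nhds_zero.1 hlim _ (ENNReal.half_pos hθ.ne'),
    eventually_ne_atTop 0] with n hn hn0
  have : NeZero n := ⟨hn0⟩
  refine iSup₂_le fun P hP => ?_
  have hTP : ∫⁻ x in A none, ‖x‖ₑ ^ p ∂(P : Measure (EuclideanSpace ℝ (Fin d))) ≤
      min c (θ / 2 * c) := by
    rw [hAo]
    exact (le_iSup₂ (f := fun (P : ProbabilityMeasure (EuclideanSpace ℝ (Fin d))) (_ : P ∈ M) =>
      ∫⁻ x in {x : EuclideanSpace ℝ (Fin d) | R < ‖x‖}, ‖x‖ₑ ^ p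
        ∂(P : Measure (EuclideanSpace ℝ (Fin d)))) P hP).trans hRT
  have htail := measure_pi_lintegral_empiricalDistribution_le hn0
    (P : Measure (EuclideanSpace ℝ (Fin d)))
    (f := (A none).indicator fun x => ‖x‖ₑ ^ p)
    (Measurable.indicator (by fun_prop) (hA none)) hc0 hctop
  simp_rw [lintegral_indicator (hA none)] at htail
  have hsub : {x : Fin n → EuclideanSpace ℝ (Fin d) | ENNReal.ofReal ε <
      wassersteinDist p (empiricalDistribution x)
        (P : Measure (EuclideanSpace ℝ (Fin d))) ^ p} ⊆
      {x | c ≤ ∫⁻ y in A none, ‖y‖ₑ ^ p ∂(empiricalDistribution x)} ∪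
      ⋃ i, {x | ENNReal.ofReal η < empiricalDistribution x (A i) -
        (P : Measure (EuclideanSpace ℝ (Fin d))) (A i)} := by
    intro x hx
    by_contra hcon
    simp only [Set.mem_union, Set.mem_iUnion, Set.mem_ofPred_eq, not_or, not_exists, not_lt,
      not_le] at hcon hx
    obtain ⟨h1, h2⟩ := hcon
    refine hx.not_ge ((wassersteinDist_rpow_le hp hA hd hu _ _ hAδ' hAR).trans ?_)
    have h3 : ENNReal.ofReal R ^ p * ∑ i, (empiricalDistribution x (A i) -
        (P : Measure (EuclideanSpace ℝ (Fin d))) (A i)) ≤ c := by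
      refine le_trans ?_ hηc.le
      calc _ ≤ ENNReal.ofReal R ^ p * ∑ _i : Option (Fin (N + 1)), ENNReal.ofReal η := by
            gcongr with i; exact h2 i
        _ = _ := by
            simp only [Finset.sum_const, Finset.card_univ, Fintype.card_option, Fintype.card_fin,
              nsmul_eq_mul, ENNReal.ofReal_coe_nnreal]
            ring
    calc _ ≤ ENNReal.ofReal (ε / 4) + K * (c + (c + c)) := by
          rw [hδp]
          gcongr
          exact hTP.trans (min_le_left _ _)
      _ = ENNReal.ofReal ε := by
          rw [mul_add, mul_add, hKc, ← ENNReal.ofReal_add hε4.le hε4.le,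
            ← ENNReal.ofReal_add hε4.le (by positivity),
            ← ENNReal.ofReal_add hε4.le (by positivity)]
          congr 1; ring
  refine (measure_mono hsub).trans ((measure_union_le _ _).trans ?_)
  rw [← ENNReal.add_halves θ]
  refine add_le_add (htail.trans (ENNReal.div_le_of_le_mul (hTP.trans (min_le_right _ _))))
    ((measure_iUnion_fintype_le _ _).trans (le_trans ?_ hn))
  calc _ ≤ ∑ _i : Option (Fin (N + 1)), ENNReal.ofReal (1 / (n * (η : ℝ) ^ 2)) :=
        Finset.sum_le_sum fun i _ =>
          measure_pi_empiricalDistribution_deviation_le hn0 _ (hA i) (NNReal.coe_pos.2 hη)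
    _ = _ := by simp [Fintype.card_option]; ring
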